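/- Let $n\in\mathbb N$, and let $S_0$ (the focal player's action set) and $S_1,\dots,S_n$ (the action sets of her opponents $1,\dots,n$) be connected (nonempty) topological spaces. Put $S_+=\prod_{i=1}^n S_i$ and $S=S_0\times S_+$, with the product topology, and write elements of $S$ as $(s_0,s_+)$. For $s_+,t_+\in S_+$ and an opponent $i$, let $(t_i,s_{-i})\in S_+$ denote the profile in which $i$ plays $t_i$ and every opponent $k\neq i$ plays $s_k$. Let $\succeq_0$ be a preference order on $S$, i.e. a complete and transitive relation, with strict part $\succ_0$ and indifference relation $\simeq_0$. An opponent $i$ is *essential at* $s_0\in S_0$ if $(s_0,s_i',s_{-i})\succ_0(s_0,s_i,s_{-i})$ for some $s_i,s_i'\in S_i$ and some actions $s_{-i}$ of the other opponents. The order $\succeq_0$ is *jointly independent* if for all $s_0,s_0'\in S_0$, all opponents $i,j$ (possibly equal), and all $s_+,s_+',t_+,t_+'\in S_+$, $$(s_0,s_+)\succeq_0(s_0',s_+'),\quad (s_0',t_j',s_{-j}')\succeq_0(s_0,t_i,s_{-i}),\quad (s_0',s_j',t_{-j}')\succeq_0(s_0,s_i,t_{-i})$$ $$\implies\quad (s_0',t_+')\succeq_0(s_0,t_+),$$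 with the last comparison strict if any one of the first three is strict. The order is *separable* if there are functions $g_i:S_0\times S_i\to\mathbb R$ $(1\le i\le n)$ such that $u(s)=\sum_{i=1}^n g_i(s_0,s_i)$ represents $\succeq_0$, that is, $s\succeq_0 t\iff u(s)\ge u(t)$ for all $s,t\in S$. **Theorem.** Assume: 1. $\succeq_0$ is continuous, i.e. for every $s\in S$ the sets $\{t: t\succ_0 s\}$ and $\{t: s\succ_0 t\}$ are open in $S$, and there exists $s_0^*\in S_0$ at which at least two (distinct) opponents are essential; 2. there is some $s_0^*\in S_0$, at which at least two opponents are essential, such that for every $(s_0,s_+)\in S$ there is $s_+^*\in S_+$ with $(s_0,s_+)\simeq_0(s_0^*,s_+^*)$. Then $\succeq_0$ is separable if and only if it is jointly independent. Moreover, the representation of $\succeq_0$ by a utility of the form $u(s)=\sum_{i=1}^n g_i(s_0,s_i)$ is unique up to a positive affine transformation: if $u$ is one such utility, then a function $u':S\to\mathbb R$ is a utility representing $\succeq_0$ of this form if and only if $u'=au+b$ for some real $a>0$ and $b$. -/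

import Mathlib

/-!
Profiles of actions.  The focal player has action set `S₀`; her `n` opponents are indexed by
`i : Fin n` and have action sets `S i`.  A profile is a pair `(s₀, s₊)` with `s₀ : S₀` and
`s₊ : ∀ i, S i`.  For opponent profiles `s` and `t`, the profile `(t_i, s_{-i})` in which opponent
`i` plays `t i` and every other opponent plays as in `s` is `swap s t i`.
-/

namespace NetworkGame

universe u v

/-- The space of profiles `S = S₀ × ∏ i, S i`; it carries the product topology. -/
abbrev Profile (S₀ : Type u) {n : ℕ} (S : Fin n → Type v) : Type (max u v) :=
  S₀ × (∀ i, S i)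

/-- The opponent profile `(t_i, s_{-i})`. -/
abbrev swap {n : ℕ} {S : Fin n → Type v} (s t : ∀ i, S i) (i : Fin n) : ∀ i, S i :=
  Function.update s i (t i)

/-- A preference order (weak order): a complete and transitive binary relation.
`R x y` reads "`x` is weakly preferred to `y`". -/
structure IsPreferenceOrder {X : Type*} (R : X → X → Prop) : Prop where
  total : ∀ x y, R x y ∨ R y x
  trans : ∀ x y z, R x y → R y z → R x z

/-- Strict preference. -/
def StrictPref {X : Type*} (R : X → X → Prop) (x y : X) : Prop :=
  R x y ∧ ¬ R y x

/-- Indifference. -/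
def Indifferent {X : Type*} (R : X → X → Prop) (x y : X) : Prop :=
  R x y ∧ R y x

/-- A preference order is continuous if all strict upper and strict lower contour sets are open. -/
def IsContinuousOrder {X : Type*} [TopologicalSpace X] (R : X → X → Prop) : Prop :=
  ∀ x, IsOpen {y | StrictPref R y x} ∧ IsOpen {y | StrictPref R x y}

/-- A real function (utility) represents the order. -/
def Represents {X : Type*} (w : X → ℝ) (R : X → X → Prop) : Prop :=
  ∀ x y, R x y ↔ w y ≤ w x

/-- A utility is additively separable across opponents:
`w (s₀, s₊) = ∑ i, g i (s₀, s_i)` for some functions `g i : S₀ × S i → ℝ`. -/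
def IsAdditivelySeparable {S₀ : Type u} {n : ℕ} {S : Fin n → Type v}
    (w : Profile S₀ S → ℝ) : Prop :=
  ∃ g : ∀ i, S₀ → S i → ℝ, ∀ (s₀ : S₀) (s : ∀ i, S i), w (s₀, s) = ∑ i, g i s₀ (s i)

/-- A preference order is separable if some additively separable utility represents it. -/
def IsSeparable {S₀ : Type u} {n : ℕ} {S : Fin n → Type v}
    (R : Profile S₀ S → Profile S₀ S → Prop) : Prop :=
  ∃ w : Profile S₀ S → ℝ, IsAdditivelySeparable w ∧ Represents w R

/-- Joint independence.  The opponents `i` and `j` may coincide. -/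
def IsJointlyIndependent {S₀ : Type u} {n : ℕ} {S : Fin n → Type v}
    (R : Profile S₀ S → Profile S₀ S → Prop) : Prop :=
  ∀ (s₀ s₀' : S₀) (i j : Fin n) (s s' t t' : ∀ k, S k),
    R (s₀, s) (s₀', s') →
    R (s₀', swap s' t' j) (s₀, swap s t i) →
    R (s₀', swap t' s' j) (s₀, swap t s i) →
      R (s₀', t') (s₀, t) ∧
      ((StrictPref R (s₀, s) (s₀', s') ∨
        StrictPref R (s₀', swap s' t' j) (s₀, swap s t i) ∨
        StrictPref R (s₀', swap t' s' j) (s₀, swap t s i)) →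
          StrictPref R (s₀', t') (s₀, t))

/-- Opponent `i` is essential at `s₀`: for some actions of the other opponents, some change of
`i`'s action alone is strictly improving for the focal player when she plays `s₀`. -/
def IsEssentialAt {S₀ : Type u} {n : ℕ} {S : Fin n → Type v}
    (R : Profile S₀ S → Profile S₀ S → Prop) (s₀ : S₀) (i : Fin n) : Prop :=
  ∃ (s : ∀ k, S k) (a b : S i),
    StrictPref R (s₀, Function.update s i b) (s₀, Function.update s i a)

/-- At least two opponents are essential at `s₀`. -/
def HasTwoEssential {S₀ : Type u} {n : ℕ} {S : Fin n → Type v}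
    (R : Profile S₀ S → Profile S₀ S → Prop) (s₀ : S₀) : Prop :=
  ∃ i j : Fin n, i ≠ j ∧ IsEssentialAt R s₀ i ∧ IsEssentialAt R s₀ j

end NetworkGame

/-!
Separable implies jointly independent by a direct computation: additive separability makes the sum
of utilities over `s, t` equal to that over `(t_i, s_{-i}), (s_i, t_{-i})`.

For the converse, fix the reference action `e₀` at which every level of preference is attained and
let `i` be an opponent essential there.  The order at `e₀` becomes an order on the product of the
actions of `i` and those of all other opponents (`factor`), and joint independence becomes triple
cancellation (`IsConjoint`).  An additive representation of such an order is found by measuring, as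
in the construction of Haar measure: `count` is the number of moves in one factor, each worth at
least a given small move in the other, that fit between two points.  It is additive up to one move
by definition, finite by connectedness (`IsConjoint.exists_not_hasChain`), and takes the same values
on equally valued intervals of the two factors, because a chain in one factor is carried to a
reversed chain in the other along an indifference curve (`IsConjoint.hasChain_flip`).  Normalized
counts have a limit along an ultrafilter as the moves become small, which gives the potentials of
the two factors (`IsConjoint.exists_additiveRep`).  The same counts are within one move of the
differences of any additive representation, which shows its uniqueness up to scale
(`IsConjoint.additiveRep_unique`).

The utility found at `e₀` is extended to all profiles by indifference, and has a range without gaps,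
so that it is continuous.  Joint independence copies a rectangle at any action `s₀`, in the
directions of any opponent `k` and of the others, onto a rectangle at `e₀` where the utility is
additive, provided its corners have utilities within some uniform `ε` of each other
(`IsJointlyIndependent.add_swap_of_small`).  As this smallness is expressed by the utility alone,
connectedness of the factors propagates additivity to all rectangles (`mixed_difference_eq_zero`),
and a function additive with respect to each opponent separately is a sum over the opponents.
-/

namespace NetworkGame

open Filter Topology Set

/-! ### Two-factor orders and chains of steps -/

section Conjoint

variable {X Y Z : Type*} [LinearOrder Z]

/-- `HasChain f q y k a a'`: one can go from `a` up to `a'` in the first factor by `k` successive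
moves, each of them worth at least as much as the move from `q` to `y` in the second factor.
Points of the first factor are compared at `q`; under triple cancellation the choice of the point
does not matter. -/
def HasChain (f : X → Y → Z) (q y : Y) : ℕ → X → X → Prop
  | 0, a, a' => f a q ≤ f a' q
  | k + 1, a, a' => ∃ c, f a y ≤ f c q ∧ HasChain f q y k c a'

/-- The largest number of moves worth at least `q → y` that fit between `a` and `a'`; it is `0` if
`a` is above `a'`. -/
noncomputable def count (f : X → Y → Z) (q y : Y) (a a' : X) : ℕ :=
  sSup {k | HasChain f q y k a a'}

/-- The moves `r → x` in the first factor and `q → y` in the second are both strictly improving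
and worth the same. -/
structure IsStep (f : X → Y → Z) (r : X) (q : Y) (x : X) (y : Y) : Prop where
  lt : f r q < f r y
  eq : f r y = f x q

theorem IsStep.flip {f : X → Y → Z} {r x : X} {q y : Y} (h : IsStep f r q x y) :
    IsStep (flip f) q r y x :=
  ⟨h.lt.trans_eq h.eq, h.eq.symm⟩

theorem hasChain_split {f : X → Y → Z} {q y : Y} {k l : ℕ} {a c : X}
    (hk : HasChain f q y (l + k) a c) :
    ∃ b, HasChain f q y k a b ∧ HasChain f q y l b c := by
  induction k generalizing a with
  | zero => exact ⟨a, le_refl (f a q), hk⟩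
  | succ k ih =>
    obtain ⟨d, hd, hk⟩ := hk
    obtain ⟨b, h₁, h₂⟩ := ih hk
    exact ⟨b, ⟨d, hd, h₁⟩, h₂⟩

variable [TopologicalSpace X] [TopologicalSpace Y] [TopologicalSpace Z]

/-- A map `f` on a two-factor product into a linear order, standing for a weak order on `X × Y`,
that is separately continuous and satisfies triple cancellation. -/
structure IsConjoint (f : X → Y → Z) : Prop where
  cont_left : ∀ y, Continuous fun x => f x y
  cont_right : ∀ x, Continuous fun y => f x y
  cancel : ∀ {a a' c c' : X} {b b' d d' : Y},
    f a' b' ≤ f a b → f c b ≤ f c' b' → f a d ≤ f a' d' → f c d ≤ f c' d'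

namespace IsConjoint

variable {f : X → Y → Z}

theorem flip (h : IsConjoint f) : IsConjoint (flip f) :=
  ⟨h.cont_right, h.cont_left, fun h₁ h₂ h₃ => h.cancel h₁ h₃ h₂⟩

/-- Triple cancellation contains independence: the comparison of two points of one factor does not
depend on the point of the other factor. -/
theorem indep_left (h : IsConjoint f) {a a' : X} {b : Y} (d : Y) (hab : f a b ≤ f a' b) :
    f a d ≤ f a' d :=
  h.cancel (le_refl (f a b)) hab le_rfl

theorem indep_right (h : IsConjoint f) {a : X} {b b' : Y} (c : X) (hab : f a b ≤ f a b') :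
    f c b ≤ f c b' :=
  h.flip.indep_left c hab

theorem indep_left_lt (h : IsConjoint f) {a a' : X} {b : Y} (d : Y) (hab : f a b < f a' b) :
    f a d < f a' d :=
  lt_of_not_ge fun hle => hab.not_ge (h.indep_left b hle)

theorem indep_right_lt (h : IsConjoint f) {a : X} {b b' : Y} (c : X) (hab : f a b < f a b') :
    f c b < f c b' :=
  h.flip.indep_left_lt c hab

theorem le_of_move (h : IsConjoint f) {q y : Y} {r a c : X} (hq : f r q < f r y)
    (hac : f a y ≤ f c q) : f a q ≤ f c q :=
  (h.indep_right_lt a hq).le.trans hac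

theorem hasChain_snoc (h : IsConjoint f) {q y : Y} {k : ℕ} {a c c' : X}
    (hk : HasChain f q y k a c) (hc : f c y ≤ f c' q) : HasChain f q y (k + 1) a c' := by
  induction k generalizing a with
  | zero => exact ⟨c', (h.indep_left y hk).trans hc, le_refl (f c' q)⟩
  | succ k ih => obtain ⟨d, hd, hk⟩ := hk; exact ⟨d, hd, ih hk⟩

theorem hasChain_mono (h : IsConjoint f) {q y : Y} {k : ℕ} {a a' b b' : X}
    (hk : HasChain f q y k a b) (ha : f a' q ≤ f a q) (hb : f b q ≤ f b' q) :
    HasChain f q y k a' b' := by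
  induction k generalizing a a' with
  | zero => exact (ha.trans hk).trans hb
  | succ k ih =>
    obtain ⟨d, hd, hk⟩ := hk
    exact ⟨d, (h.indep_left y ha).trans hd, ih hk le_rfl⟩

theorem hasChain_append (h : IsConjoint f) {q y : Y} {k l : ℕ} {a b c : X}
    (hk : HasChain f q y k a b) (hl : HasChain f q y l b c) : HasChain f q y (l + k) a c := by
  induction k generalizing a with
  | zero => exact h.hasChain_mono hl hk le_rfl
  | succ k ih => obtain ⟨d, hd, hk⟩ := hk; exact ⟨d, hd, ih hk⟩

theorem le_of_hasChain (h : IsConjoint f) {q y : Y} {r : X} (hq : f r q < f r y) {k : ℕ}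
    {a b : X} (hk : HasChain f q y k a b) : f a q ≤ f b q := by
  induction k generalizing a with
  | zero => exact hk
  | succ k ih => obtain ⟨d, hd, hk⟩ := hk; exact (h.le_of_move hq hd).trans (ih hk)

theorem hasChain_of_le (h : IsConjoint f) {q y : Y} {r : X} (hq : f r q < f r y) {k l : ℕ}
    {a b : X} (hk : HasChain f q y k a b) (hl : l ≤ k) : HasChain f q y l a b := by
  obtain ⟨m, rfl⟩ := Nat.exists_eq_add_of_le' hl
  obtain ⟨c, h₁, h₂⟩ := hasChain_split hk
  exact h.hasChain_mono h₁ le_rfl (h.le_of_hasChain hq h₂)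

/-- A chain from `a` to `c` breaks at any intermediate point `b` with the loss of at most one
move. -/
theorem not_hasChain_add (h : IsConjoint f) {q y : Y} {k l : ℕ} {a b c : X}
    (hk : ¬ HasChain f q y k a b) (hl : ¬ HasChain f q y l b c) :
    ¬ HasChain f q y (l + k) a c := by
  intro H
  obtain ⟨m, h₁, h₂⟩ := hasChain_split H
  rcases le_total (f m q) (f b q) with hm | hm
  · exact hk (h.hasChain_mono h₁ le_rfl hm)
  · exact hl (h.hasChain_mono h₂ hm le_rfl)

theorem count_eq_zero (h : IsConjoint f) {q y : Y} {r : X}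
    (hq : f r q < f r y) {a b : X} (hab : f b q ≤ f a q) : count f q y a b = 0 := by
  refine Nat.le_zero.1 (csSup_le' ?_)
  rintro (_ | k) hk
  · exact le_rfl
  · obtain ⟨c, hc, hk⟩ := hk
    exact absurd ((h.le_of_hasChain hq hk).trans hab)
      ((h.indep_right_lt a hq).trans_le hc).not_ge

variable [OrderTopology Z]

/-- The Archimedean property: it follows from connectedness, since the points that can be reached
from `a` by boundedly many moves form a clopen set. -/
theorem exists_not_hasChain [PreconnectedSpace X] (h : IsConjoint f) {q y : Y} {r : X}
    (hq : f r q < f r y) (a b : X) : ∃ k, ¬ HasChain f q y k a b := by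
  have not_one : ∀ c c' : X, f c' q < f c y → ¬ HasChain f q y 1 c c' := by
    rintro c c' hc ⟨d, hd, hd'⟩
    exact (hd.trans hd').not_gt hc
  let B : Set X := {x | ∃ k, ¬ HasChain f q y k a x}
  have hB : IsClopen B := by
    constructor
    · rw [← isOpen_compl_iff, isOpen_iff_mem_nhds]
      intro x hx
      have hop : IsOpen {x' | f x q < f x' y} := isOpen_lt continuous_const (h.cont_left y)
      refine mem_of_superset (hop.mem_nhds (h.indep_right_lt x hq)) ?_
      rintro x' hx' ⟨k, hk⟩
      exact hx ⟨1 + k, h.not_hasChain_add hk (not_one _ _ hx')⟩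
    · rw [isOpen_iff_mem_nhds]
      rintro x ⟨k, hk⟩
      have hop : IsOpen {x' | f x' q < f x y} := isOpen_lt (h.cont_left q) continuous_const
      refine mem_of_superset (hop.mem_nhds (h.indep_right_lt x hq)) ?_
      intro x' hx'
      exact ⟨1 + k, h.not_hasChain_add hk (not_one _ _ hx')⟩
  have huniv := hB.eq_univ ⟨a, 1, not_one _ _ (h.indep_right_lt a hq)⟩
  have : b ∈ B := huniv ▸ mem_univ b
  exact this

theorem bddAbove_hasChain [PreconnectedSpace X] (h : IsConjoint f) {q y : Y} {r : X}
    (hq : f r q < f r y) (a b : X) : BddAbove {k | HasChain f q y k a b} := by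
  obtain ⟨k, hk⟩ := h.exists_not_hasChain hq a b
  exact ⟨k, fun l hl => le_of_not_ge fun hkl => hk (h.hasChain_of_le hq hl hkl)⟩

theorem le_count [PreconnectedSpace X] (h : IsConjoint f) {q y : Y} {r : X}
    (hq : f r q < f r y) {a b : X} {k : ℕ} (hk : HasChain f q y k a b) : k ≤ count f q y a b :=
  le_csSup (h.bddAbove_hasChain hq a b) hk

theorem hasChain_count [PreconnectedSpace X] (h : IsConjoint f) {q y : Y} {r : X}
    (hq : f r q < f r y) {a b : X} (hab : f a q ≤ f b q) :
    HasChain f q y (count f q y a b) a b :=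
  Nat.sSup_mem (s := {k | HasChain f q y k a b}) ⟨0, hab⟩ (h.bddAbove_hasChain hq a b)

theorem not_hasChain_count [PreconnectedSpace X] (h : IsConjoint f) {q y : Y} {r : X}
    (hq : f r q < f r y) (a b : X) : ¬ HasChain f q y (count f q y a b + 1) a b :=
  fun H => absurd (h.le_count hq H) (by simp)

theorem count_add_le [PreconnectedSpace X] (h : IsConjoint f) {q y : Y} {r : X}
    (hq : f r q < f r y) {a b c : X} (hab : f a q ≤ f b q) (hbc : f b q ≤ f c q) :
    count f q y a b + count f q y b c ≤ count f q y a c := by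
  rw [add_comm]
  exact h.le_count hq (h.hasChain_append (h.hasChain_count hq hab) (h.hasChain_count hq hbc))

theorem count_le_add [PreconnectedSpace X] (h : IsConjoint f) {q y : Y} {r : X}
    (hq : f r q < f r y) (a b c : X) :
    count f q y a c ≤ count f q y a b + count f q y b c + 1 := by
  by_contra! hlt
  rcases le_total (f a q) (f c q) with hac | hac
  · exact h.not_hasChain_add (h.not_hasChain_count hq a b) (h.not_hasChain_count hq b c)
      (h.hasChain_of_le hq (h.hasChain_count hq hac) (by omega))
  · rw [h.count_eq_zero hq hac] at hlt
    omega

/-- Restricted solvability in the first factor. -/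
theorem exists_eq_left [PreconnectedSpace X] (h : IsConjoint f) {a a' : X} {y : Y} {z : Z}
    (h₁ : f a y ≤ z) (h₂ : z ≤ f a' y) : ∃ x, f x y = z :=
  intermediate_value_univ a a' (h.cont_left y) ⟨h₁, h₂⟩

theorem exists_eq_right [PreconnectedSpace Y] (h : IsConjoint f) {b b' : Y} {x : X} {z : Z}
    (h₁ : f x b ≤ z) (h₂ : z ≤ f x b') : ∃ y, f x y = z :=
  h.flip.exists_eq_left h₁ h₂

/-- Comparison of the two factors.  If moving from `c` to `c'` is worth at most as much as moving
from `b` to `b'`, a chain from `c` to `c'` is carried along the indifference curve through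
`(c', b)` to a chain from `b` to `b'`, its order being reversed. -/
theorem hasChain_flip [PreconnectedSpace Y] (h : IsConjoint f) {r x : X} {q y : Y}
    (hs : IsStep f r q x y) {k : ℕ} {c c' : X} {b b' : Y} (hcb : f c' b ≤ f c b')
    (hk : HasChain f q y k c c') : HasChain (_root_.flip f) r x k b b' := by
  induction k generalizing c b' with
  | zero =>
    have h₁ : f c b ≤ f c' b := h.indep_left b hk
    exact h.indep_right r (h₁.trans hcb)
  | succ k ih =>
    obtain ⟨d, hd, hk⟩ := hk
    have h₁ : f d b ≤ f c' b := h.indep_left b (h.le_of_hasChain hs.lt hk)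
    have h₂ : f c b' ≤ f d b' := h.indep_left b' (h.le_of_move hs.lt hd)
    obtain ⟨e, he⟩ := h.exists_eq_right h₁ (hcb.trans h₂)
    refine h.flip.hasChain_snoc (ih he.ge hk) ?_
    exact h.cancel hd hs.eq.ge (he.trans_le hcb)

theorem count_flip_le [PreconnectedSpace X] [PreconnectedSpace Y] (h : IsConjoint f) {r x : X}
    {q y : Y} (hs : IsStep f r q x y) {c c' : X} {b b' : Y} (hcb : f c' b ≤ f c b') :
    count f q y c c' ≤ count (_root_.flip f) r x b b' := by
  rcases le_total (f c q) (f c' q) with hc | hc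
  · exact h.flip.le_count hs.flip.lt (h.hasChain_flip hs hcb (h.hasChain_count hs.lt hc))
  · rw [h.count_eq_zero hs.lt hc]
    exact Nat.zero_le _

theorem le_count_flip [PreconnectedSpace X] [PreconnectedSpace Y] (h : IsConjoint f) {r x : X}
    {q y : Y} (hs : IsStep f r q x y) {c c' : X} {b b' : Y} (hcb : f c b' ≤ f c' b) :
    count (_root_.flip f) r x b b' ≤ count f q y c c' :=
  h.flip.count_flip_le hs.flip hcb

theorem count_flip_eq [PreconnectedSpace X] [PreconnectedSpace Y] (h : IsConjoint f) {r x : X}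
    {q y : Y} (hs : IsStep f r q x y) {c c' : X} {b b' : Y} (hcb : f c b' = f c' b) :
    count (_root_.flip f) r x b b' = count f q y c c' :=
  le_antisymm (h.le_count_flip hs hcb.le) (h.count_flip_le hs hcb.ge)

/-- Change of scale: the number of small moves is bounded by the number of large moves times the
number of small moves in an interval `a → a'` worth at least one large move. -/
theorem count_le_mul [PreconnectedSpace X] [PreconnectedSpace Y] (h : IsConjoint f) {r x : X}
    {q y p : Y} (hs : IsStep f r q x y) (hp : f r q < f r p) {a a' : X} (ha : f a p ≤ f a' q)
    (c d : X) :
    count f q y c d ≤ (count f q p c d + 1) * (count f q y a a' + 1) := by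
  rcases le_total (f c q) (f d q) with hcd | hcd
  swap
  · rw [h.count_eq_zero hs.lt hcd]
    exact Nat.zero_le _
  by_contra! hlt
  -- cut a longest chain from `c` to `d` into blocks:
  -- every block of `count f q y a a' + 1` small moves is worth at least one large move
  have block : ∀ e e', HasChain f q y (count f q y a a' + 1) e e' → f e p ≤ f e' q := by
    intro e e' he
    by_contra! hlt
    have h₁ := h.le_count hs.lt he
    have h₂ := h.count_flip_le hs hlt.le
    have h₃ := h.le_count_flip hs ha
    omega
  have blocks : ∀ k e, HasChain f q y (k * (count f q y a a' + 1)) e d → HasChain f q p k e d := by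
    intro k
    induction k with
    | zero => intro e he; rw [zero_mul] at he; exact he
    | succ k ih =>
      intro e he
      rw [Nat.succ_mul] at he
      obtain ⟨b, h₁, h₂⟩ := hasChain_split he
      exact ⟨b, block _ _ h₁, ih _ h₂⟩
  exact h.not_hasChain_count hp c d
    (blocks _ c (h.hasChain_of_le hs.lt (h.hasChain_count hs.lt hcd) hlt.le))

/-! ### Existence of arbitrarily small steps -/

/-- Below the reference step, each move in the second factor has a counterpart in the first. -/
theorem exists_isStep [PreconnectedSpace X] (h : IsConjoint f) {r r₁ : X} {q q₁ y : Y}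
    (hr : IsStep f r q r₁ q₁) (hy : f r q < f r y) (hy₁ : f r y ≤ f r q₁) :
    ∃ x, IsStep f r q x y := by
  obtain ⟨x, hx⟩ := h.exists_eq_left (y := q) hy.le (hy₁.trans hr.eq.le)
  exact ⟨x, hy, hx.symm⟩

/-- Every strictly improving interval contains chains of any length. -/
theorem exists_isStep_hasChain [PreconnectedSpace X] [PreconnectedSpace Y] (h : IsConjoint f)
    {r r₁ : X} {q q₁ : Y} (hr : IsStep f r q r₁ q₁) (k : ℕ) {a a' : X} (ha : f a q < f a' q) :
    ∃ x y, IsStep f r q x y ∧ HasChain f q y k a a' := by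
  suffices H : ∃ y, f r q < f r y ∧ f r y ≤ f r q₁ ∧ HasChain f q y k a a' by
    obtain ⟨y, h₁, h₂, h₃⟩ := H
    obtain ⟨x, hx⟩ := h.exists_isStep hr h₁ h₂
    exact ⟨x, y, hx, h₃⟩
  induction k generalizing a with
  | zero => exact ⟨q₁, hr.lt, le_rfl, ha.le⟩
  | succ k ih =>
    obtain ⟨m, hm', hm⟩ : ({x | f x q < f a' q} ∩ {x | f a q < f x q}).Nonempty := by
      refine nonempty_inter (isOpen_lt (h.cont_left q) continuous_const)
        (isOpen_lt continuous_const (h.cont_left q)) ?_ ⟨a, ha⟩ ⟨a', ha⟩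
      refine eq_univ_of_forall fun x => ?_
      rcases lt_or_ge (f x q) (f a' q) with hx | hx
      · exact Or.inl hx
      · exact Or.inr (ha.trans_le hx)
    obtain ⟨y, h₁, h₂, h₃⟩ := ih hm'
    -- the smaller of the step used between `m` and `a'` and of a step that fits between `a` and `m`
    rcases le_total (f a y) (f m q) with hy | hy
    · exact ⟨y, h₁, h₂, m, hy, h₃⟩
    obtain ⟨y', hy'⟩ := h.exists_eq_right (le_of_lt hm) hy
    have hyy : f a y' ≤ f a y := hy'.trans_le hy
    refine ⟨y', h.indep_right_lt r ((show f a q < f m q from hm).trans_eq hy'.symm),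
      (h.indep_right r hyy).trans h₂, m, hy'.le, ?_⟩
    clear ih hm hm' hy hy'
    induction k generalizing m with
    | zero => exact h₃
    | succ k ih =>
      obtain ⟨c, hc, h₃⟩ := h₃
      exact ⟨c, (h.indep_right m hyy).trans hc, ih c h₃⟩

theorem exists_isStep_le [PreconnectedSpace X] [PreconnectedSpace Y] (h : IsConjoint f)
    {r r₁ : X} {q q₁ : Y} (hr : IsStep f r q r₁ q₁) {a a' : X} (ha : f a q < f a' q) :
    ∃ x y, IsStep f r q x y ∧ f a y ≤ f a' q := by
  obtain ⟨x, y, hs, c, hc, hc'⟩ := h.exists_isStep_hasChain hr 1 ha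
  exact ⟨x, y, hs, hc.trans hc'⟩

end IsConjoint

end Conjoint

/-! ### Additive representations on two factors -/

section Additive

variable {X Y Z : Type*} [LinearOrder Z]

/-- `φ a + ψ b` represents the order on `X × Y` induced by `f`. -/
def IsAdditiveRep (f : X → Y → Z) (φ : X → ℝ) (ψ : Y → ℝ) : Prop :=
  ∀ a b a' b', f a b ≤ f a' b' ↔ φ a + ψ b ≤ φ a' + ψ b'

namespace IsAdditiveRep

variable {f : X → Y → Z} {φ : X → ℝ} {ψ : Y → ℝ}

theorem flip (H : IsAdditiveRep f φ ψ) : IsAdditiveRep (flip f) ψ φ := fun b a b' a' => by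
  rw [add_comm (ψ b), add_comm (ψ b')]
  exact H a b a' b'

theorem lt_iff (H : IsAdditiveRep f φ ψ) (a : X) (b : Y) (a' : X) (b' : Y) :
    f a b < f a' b' ↔ φ a + ψ b < φ a' + ψ b' := by
  rw [← not_le, ← not_le, H]

theorem eq_iff (H : IsAdditiveRep f φ ψ) (a : X) (b : Y) (a' : X) (b' : Y) :
    f a b = f a' b' ↔ φ a + ψ b = φ a' + ψ b' := by
  rw [le_antisymm_iff, le_antisymm_iff, H, H]

theorem mul_le_of_hasChain (H : IsAdditiveRep f φ ψ) {q y : Y} {k : ℕ} {a a' : X}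
    (hk : HasChain f q y k a a') : k * (ψ y - ψ q) ≤ φ a' - φ a := by
  induction k generalizing a with
  | zero =>
    have := (H _ _ _ _).1 hk
    push_cast
    linarith
  | succ k ih =>
    obtain ⟨c, hc, hk⟩ := hk
    have := (H _ _ _ _).1 hc
    have := ih hk
    push_cast
    linarith

end IsAdditiveRep

variable [TopologicalSpace X] [TopologicalSpace Y] [TopologicalSpace Z] [OrderTopology Z]

namespace IsConjoint

variable {f : X → Y → Z}

/-- A reference pair of equally valued moves exists as soon as both factors matter. -/
theorem exists_isStep_of_lt [PreconnectedSpace X] [PreconnectedSpace Y] (h : IsConjoint f)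
    {a a' c : X} {b b' d : Y} (ha : f a d < f a' d) (hb : f c b < f c b') :
    ∃ r q r₁ q₁, IsStep f r q r₁ q₁ := by
  have ha' := h.indep_left_lt b ha
  have hb' := h.indep_right_lt a hb
  rcases le_total (f a b') (f a' b) with hab | hab
  · obtain ⟨r₁, hr⟩ := h.exists_eq_left hb'.le hab
    exact ⟨a, b, r₁, b', hb', hr.symm⟩
  · obtain ⟨q₁, hq⟩ := h.exists_eq_right ha'.le hab
    exact ⟨a, b, a', q₁, ha'.trans_eq hq.symm, hq⟩

/-- By solvability the moves of a chain can be chosen exactly equal to the step, so that an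
interval without a chain of length `k` has value at most `k` steps. -/
theorem sub_le_mul_of_not_hasChain [PreconnectedSpace X] (h : IsConjoint f) {φ : X → ℝ}
    {ψ : Y → ℝ} (H : IsAdditiveRep f φ ψ) {r : X} {q y : Y} (hq : f r q < f r y) {k : ℕ}
    {a a' : X} (hk : ¬ HasChain f q y k a a') : φ a' - φ a ≤ k * (ψ y - ψ q) := by
  have hδ := (H.lt_iff _ _ _ _).1 hq
  induction k generalizing a with
  | zero =>
    have := (H.lt_iff _ _ _ _).1 (not_le.1 hk)
    push_cast
    linarith
  | succ k ih =>
    rcases le_or_gt (f a y) (f a' q) with hy | hy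
    · obtain ⟨c, hc⟩ := h.exists_eq_left (h.indep_right_lt a hq).le hy
      have h₁ := ih fun hch => hk ⟨c, hc.ge, hch⟩
      have h₂ := (H.eq_iff _ _ _ _).1 hc
      push_cast
      linarith
    · have h₁ := (H.lt_iff _ _ _ _).1 hy
      have h₂ : 0 ≤ (k : ℝ) * (ψ y - ψ q) := mul_nonneg k.cast_nonneg (by linarith)
      push_cast
      linarith

/-- The normalized numbers of moves converge to the normalized differences of any additive
representation. -/
theorem tendsto_count_div [PreconnectedSpace X] (h : IsConjoint f) {φ : X → ℝ} {ψ : Y → ℝ}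
    (H : IsAdditiveRep f φ ψ) {r r₁ : X} {q : Y} {y : ℕ → Y} (hr : f r q < f r₁ q)
    (hy : ∀ k, f r q < f r (y k)) (hm : ∀ k, k ≤ count f q (y k) r r₁) {a b : X}
    (hab : f a q ≤ f b q) :
    Tendsto (fun k => (count f q (y k) a b : ℝ) / count f q (y k) r r₁) atTop
      (𝓝 ((φ b - φ a) / (φ r₁ - φ r))) := by
  have hE : 0 < φ r₁ - φ r := by linarith [(H.lt_iff _ _ _ _).1 hr]
  have hm' : Tendsto (fun k => (count f q (y k) r r₁ : ℝ)) atTop atTop :=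
    tendsto_natCast_atTop_atTop.comp (tendsto_atTop_mono hm tendsto_id)
  have hinv := tendsto_inv_atTop_zero.comp hm'
  have h₁ : Tendsto (fun k => (φ b - φ a) / (φ r₁ - φ r) - (count f q (y k) r r₁ : ℝ)⁻¹) atTop
      (𝓝 ((φ b - φ a) / (φ r₁ - φ r))) := by
    simpa using tendsto_const_nhds.sub hinv
  have h₂ : Tendsto (fun k => (φ b - φ a) / (φ r₁ - φ r) +
      (φ b - φ a) / (φ r₁ - φ r) * (count f q (y k) r r₁ : ℝ)⁻¹) atTop
      (𝓝 ((φ b - φ a) / (φ r₁ - φ r))) := by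
    simpa using tendsto_const_nhds.add (hinv.const_mul ((φ b - φ a) / (φ r₁ - φ r)))
  have hbounds : ∀ k, 1 ≤ k →
      (φ b - φ a) / (φ r₁ - φ r) - (count f q (y k) r r₁ : ℝ)⁻¹ ≤
        (count f q (y k) a b : ℝ) / count f q (y k) r r₁ ∧
      (count f q (y k) a b : ℝ) / count f q (y k) r r₁ ≤ (φ b - φ a) / (φ r₁ - φ r) +
        (φ b - φ a) / (φ r₁ - φ r) * (count f q (y k) r r₁ : ℝ)⁻¹ := by
    intro k hk
    have e₁ := H.mul_le_of_hasChain (h.hasChain_count (hy k) hab)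
    have e₂ := h.sub_le_mul_of_not_hasChain H (hy k) (h.not_hasChain_count (hy k) a b)
    have e₃ := H.mul_le_of_hasChain (h.hasChain_count (hy k) hr.le)
    have e₄ := h.sub_le_mul_of_not_hasChain H (hy k) (h.not_hasChain_count (hy k) r r₁)
    have hδ : 0 < ψ (y k) - ψ q := by linarith [(H.lt_iff _ _ _ _).1 (hy k)]
    have hmpos : (0 : ℝ) < count f q (y k) r r₁ := by exact_mod_cast hk.trans (hm k)
    push_cast at e₂ e₄
    generalize (count f q (y k) r r₁ : ℝ) = m at *
    have hN : (0 : ℝ) ≤ count f q (y k) a b := Nat.cast_nonneg _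
    generalize (count f q (y k) a b : ℝ) = N at *
    generalize ψ (y k) - ψ q = δ at *
    generalize φ b - φ a = D at *
    generalize φ r₁ - φ r = E at *
    constructor
    · have : m * D ≤ (N + 1) * E := calc
        m * D ≤ m * ((N + 1) * δ) := by gcongr
        _ = (N + 1) * (m * δ) := by ring
        _ ≤ (N + 1) * E := by gcongr
      rw [sub_le_iff_le_add, inv_eq_one_div, ← add_div, div_le_div_iff₀ hE hmpos]
      linarith
    · have : N * E ≤ (m + 1) * D := calc
        N * E ≤ N * ((m + 1) * δ) := by gcongr
        _ = (m + 1) * (N * δ) := by ring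
        _ ≤ (m + 1) * D := by gcongr
      have e : D / E + D / E * m⁻¹ = D * (m + 1) / (E * m) := by field_simp
      rw [e, div_le_div_iff₀ hmpos (by positivity)]
      nlinarith
  exact tendsto_of_tendsto_of_tendsto_of_le_of_le' h₁ h₂
    ((eventually_ge_atTop 1).mono fun k hk => (hbounds k hk).1)
    ((eventually_ge_atTop 1).mono fun k hk => (hbounds k hk).2)

/-- A sequence of steps, arbitrarily many of which fit into the reference interval. -/
theorem exists_isStep_seq [PreconnectedSpace X] [PreconnectedSpace Y] (h : IsConjoint f)
    {r r₁ : X} {q q₁ : Y} (hr : IsStep f r q r₁ q₁) :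
    ∃ (x : ℕ → X) (y : ℕ → Y), (∀ k, IsStep f r q (x k) (y k)) ∧
      ∀ k, k ≤ count f q (y k) r r₁ := by
  choose x y hs hc using fun k => h.exists_isStep_hasChain hr k (hr.lt.trans_eq hr.eq)
  exact ⟨x, y, hs, fun k => h.le_count (hs k).lt (hc k)⟩

/-- Differences of the first potential relative to the reference interval are the same for all
additive representations, being limits of the same normalized counts. -/
theorem sub_eq_div_mul_sub [PreconnectedSpace X] [PreconnectedSpace Y] (h : IsConjoint f)
    {φ φ' : X → ℝ} {ψ ψ' : Y → ℝ} (H : IsAdditiveRep f φ ψ) (H' : IsAdditiveRep f φ' ψ')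
    {r r₁ : X} {q q₁ : Y} (hr : IsStep f r q r₁ q₁) (a b : X) :
    φ' b - φ' a = (φ' r₁ - φ' r) / (φ r₁ - φ r) * (φ b - φ a) := by
  obtain ⟨x, y, hs, hm⟩ := h.exists_isStep_seq hr
  have hlt : f r q < f r₁ q := hr.lt.trans_eq hr.eq
  have hE : 0 < φ r₁ - φ r := by linarith [(H.lt_iff _ _ _ _).1 hlt]
  have hE' : 0 < φ' r₁ - φ' r := by linarith [(H'.lt_iff _ _ _ _).1 hlt]
  have key : ∀ a b, f a q ≤ f b q →
      φ' b - φ' a = (φ' r₁ - φ' r) / (φ r₁ - φ r) * (φ b - φ a) := by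
    intro a b hab
    have := tendsto_nhds_unique (h.tendsto_count_div H hlt (fun k => (hs k).lt) hm hab)
      (h.tendsto_count_div H' hlt (fun k => (hs k).lt) hm hab)
    rw [div_eq_div_iff hE.ne' hE'.ne'] at this
    field_simp
    linarith
  rcases le_total (f a q) (f b q) with hab | hab
  · exact key a b hab
  · linarith [key b a hab]

/-- Additive representations on two essential factors are unique up to a common positive scale
factor and translations. -/
theorem additiveRep_unique [PreconnectedSpace X] [PreconnectedSpace Y] (h : IsConjoint f)
    {φ φ' : X → ℝ} {ψ ψ' : Y → ℝ} (H : IsAdditiveRep f φ ψ) (H' : IsAdditiveRep f φ' ψ')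
    {r r₁ : X} {q q₁ : Y} (hr : IsStep f r q r₁ q₁) :
    ∃ ρ : ℝ, 0 < ρ ∧ ∀ a b a' b',
      (φ' a' + ψ' b') - (φ' a + ψ' b) = ρ * ((φ a' + ψ b') - (φ a + ψ b)) := by
  have hlt : f r q < f r₁ q := hr.lt.trans_eq hr.eq
  have hE : 0 < φ r₁ - φ r := by linarith [(H.lt_iff _ _ _ _).1 hlt]
  have hE' : 0 < φ' r₁ - φ' r := by linarith [(H'.lt_iff _ _ _ _).1 hlt]
  refine ⟨_, div_pos hE' hE, fun a b a' b' => ?_⟩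
  have h₁ := h.sub_eq_div_mul_sub H H' hr a a'
  have h₂ := h.flip.sub_eq_div_mul_sub H.flip H'.flip hr.flip b b'
  have e : ψ q₁ - ψ q = φ r₁ - φ r := by linarith [(H.eq_iff _ _ _ _).1 hr.eq]
  have e' : ψ' q₁ - ψ' q = φ' r₁ - φ' r := by linarith [(H'.eq_iff _ _ _ _).1 hr.eq]
  rw [e, e'] at h₂
  linear_combination h₁ + h₂

/-- The number of moves from `r` up to `a`, counted negatively if `a` is below `r`, is additive up
to an error of one move. -/
theorem abs_signedCount_sub_le [PreconnectedSpace X] (h : IsConjoint f) {q y : Y} {r s : X}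
    (hq : f s q < f s y) {a b : X} (hab : f a q ≤ f b q) :
    |((count f q y r b : ℝ) - count f q y b r) - (count f q y r a - count f q y a r) -
      count f q y a b| ≤ 1 := by
  rw [abs_le]
  rcases le_total (f r q) (f a q) with hra | hra
  · have h₁ := h.count_eq_zero hq hra
    have h₂ := h.count_eq_zero hq (hra.trans hab)
    have h₃ : (count f q y r a : ℝ) + count f q y a b ≤ count f q y r b := by
      exact_mod_cast h.count_add_le hq hra hab
    have h₄ : (count f q y r b : ℝ) ≤ count f q y r a + count f q y a b + 1 := by
      exact_mod_cast h.count_le_add hq r a b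
    rw [h₁, h₂]
    constructor <;> push_cast <;> linarith
  rcases le_total (f b q) (f r q) with hrb | hrb
  · have h₁ := h.count_eq_zero hq hrb
    have h₂ := h.count_eq_zero hq hra
    have h₃ : (count f q y a b : ℝ) + count f q y b r ≤ count f q y a r := by
      exact_mod_cast h.count_add_le hq hab hrb
    have h₄ : (count f q y a r : ℝ) ≤ count f q y a b + count f q y b r + 1 := by
      exact_mod_cast h.count_le_add hq a b r
    rw [h₁, h₂]
    constructor <;> push_cast <;> linarith
  · have h₁ := h.count_eq_zero hq hrb
    have h₂ := h.count_eq_zero hq hra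
    have h₃ : (count f q y a r : ℝ) + count f q y r b ≤ count f q y a b := by
      exact_mod_cast h.count_add_le hq hra hrb
    have h₄ : (count f q y a b : ℝ) ≤ count f q y a r + count f q y r b + 1 := by
      exact_mod_cast h.count_le_add hq a r b
    rw [h₁, h₂]
    constructor <;> push_cast <;> linarith

/-- The potential of the first factor: the limit, along an ultrafilter, of the normalized signed
numbers of moves as the moves become small.  It is strictly monotone, and its differences are the
limits of the normalized numbers of moves. -/
theorem exists_tendsto_count_div [PreconnectedSpace X] [PreconnectedSpace Y] (h : IsConjoint f)
    {r r₁ : X} {q q₁ : Y} (hr : IsStep f r q r₁ q₁) {x : ℕ → X} {y : ℕ → Y}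
    (hs : ∀ k, IsStep f r q (x k) (y k)) (hm : ∀ k, k ≤ count f q (y k) r r₁) :
    ∃ φ : X → ℝ, (∀ a b, f a q ≤ f b q → φ a ≤ φ b) ∧ (∀ a b, f a q < f b q → φ a < φ b) ∧
      ∀ a b, f a q ≤ f b q →
        Tendsto (fun k => (count f q (y k) a b : ℝ) / count f q (y k) r r₁) (hyperfilter ℕ)
          (𝓝 (φ b - φ a)) := by
  set P : X → ℕ → ℝ := fun a k =>
    ((count f q (y k) r a : ℝ) - count f q (y k) a r) / count f q (y k) r r₁ with hP
  have bound : ∀ c d k, (count f q (y k) c d : ℝ) / count f q (y k) r r₁ ≤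
      2 * (count f q q₁ c d + 1) := by
    intro c d k
    have h₁ : (count f q (y k) c d : ℝ) ≤
        (count f q q₁ c d + 1) * (count f q (y k) r r₁ + 1) := by
      exact_mod_cast h.count_le_mul (hs k) hr.lt hr.eq.le c d
    rcases Nat.eq_zero_or_pos (count f q (y k) r r₁) with h0 | h0
    · rw [h0]
      simp only [Nat.cast_zero, div_zero]
      positivity
    · have h2 : (1 : ℝ) ≤ count f q (y k) r r₁ := by exact_mod_cast h0
      rw [div_le_iff₀ (by linarith)]
      calc _ ≤ _ := h₁
        _ ≤ ((count f q q₁ c d : ℝ) + 1) * (2 * count f q (y k) r r₁) := by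
          gcongr
          linarith
        _ = _ := by ring
  have lim : ∀ a, ∃ l, Tendsto (P a) (hyperfilter ℕ) (𝓝 l) := by
    intro a
    have hmem : ∀ k, P a k ∈ Icc (-(2 * ((count f q q₁ a r : ℝ) + 1)))
        (2 * ((count f q q₁ r a : ℝ) + 1)) := by
      intro k
      have n₁ : 0 ≤ (count f q (y k) r a : ℝ) / count f q (y k) r r₁ := by positivity
      have n₂ : 0 ≤ (count f q (y k) a r : ℝ) / count f q (y k) r r₁ := by positivity
      have h₁ := bound r a k
      have h₂ := bound a r k
      simp only [hP, sub_div, mem_Icc]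
      constructor <;> linarith
    obtain ⟨l, -, hl⟩ := isCompact_Icc.ultrafilter_le_nhds ((hyperfilter ℕ).map (P a))
      (by
        rw [Ultrafilter.coe_map, le_principal_iff, mem_map]
        exact univ_mem' hmem)
    exact ⟨l, hl⟩
  choose φ hφ using lim
  have hm' : Tendsto (fun k => (count f q (y k) r r₁ : ℝ)) (hyperfilter ℕ) atTop :=
    (tendsto_natCast_atTop_atTop.comp (tendsto_atTop_mono hm tendsto_id)).mono_left
      Nat.hyperfilter_le_atTop
  have hinv : Tendsto (fun k => (count f q (y k) r r₁ : ℝ)⁻¹) (hyperfilter ℕ) (𝓝 0) :=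
    tendsto_inv_atTop_zero.comp hm'
  have hlim : ∀ a b, f a q ≤ f b q →
      Tendsto (fun k => (count f q (y k) a b : ℝ) / count f q (y k) r r₁) (hyperfilter ℕ)
        (𝓝 (φ b - φ a)) := by
    intro a b hab
    have herr : Tendsto (fun k => (P b k - P a k) -
        (count f q (y k) a b : ℝ) / count f q (y k) r r₁) (hyperfilter ℕ) (𝓝 0) := by
      refine squeeze_zero_norm (fun k => ?_) hinv
      have := h.abs_signedCount_sub_le (r := r) (hs k).lt hab
      simp only [hP, ← sub_div]
      rw [Real.norm_eq_abs, abs_div, Nat.abs_cast, inv_eq_one_div]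
      gcongr
    simpa using ((hφ b).sub (hφ a)).sub herr
  refine ⟨φ, fun a b hab => sub_nonneg.1 (ge_of_tendsto' (hlim a b hab) fun k => by positivity),
    fun a b hab => ?_, hlim⟩
  have ev : ∀ᶠ k in (hyperfilter ℕ : Filter ℕ), (1 : ℝ) ≤ count f q (y k) r r₁ := by
    refine Nat.hyperfilter_le_atTop ((eventually_ge_atTop 1).mono fun k hk => ?_)
    exact_mod_cast hk.trans (hm k)
  -- the interval contains a full step, and boundedly many copies of it cover the reference interval
  obtain ⟨u, v, huv, hv⟩ := h.exists_isStep_le hr hab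
  set M : ℝ := count f q v r r₁ + 1 with hM
  have hMpos : 0 < M := by positivity
  have h1 : 1 ≤ M * (φ b - φ a + 0) := by
    refine ge_of_tendsto (((hlim a b hab.le).add hinv).const_mul M) (ev.mono fun k hk => ?_)
    have h₁ : (count f q (y k) r r₁ : ℝ) ≤ M * (count f q (y k) a b + 1) := by
      rw [hM]
      exact_mod_cast h.count_le_mul (hs k) huv.lt hv r r₁
    rw [inv_eq_one_div, ← add_div, ← mul_div_assoc, le_div_iff₀ (by linarith), one_mul]
    exact h₁
  by_contra! hle
  nlinarith

/-- Existence of an additive representation on two essential factors. -/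
theorem exists_additiveRep [PreconnectedSpace X] [PreconnectedSpace Y] (h : IsConjoint f)
    {r r₁ : X} {q q₁ : Y} (hr : IsStep f r q r₁ q₁) :
    ∃ (φ : X → ℝ) (ψ : Y → ℝ), IsAdditiveRep f φ ψ := by
  obtain ⟨x, y, hs, hm⟩ := h.exists_isStep_seq hr
  have hms : ∀ k, count (_root_.flip f) r (x k) q q₁ = count f q (y k) r r₁ :=
    fun k => h.count_flip_eq (hs k) hr.eq
  obtain ⟨φ, monoφ, strictφ, hφ⟩ := h.exists_tendsto_count_div hr hs hm
  obtain ⟨ψ, monoψ, strictψ, hψ⟩ := h.flip.exists_tendsto_count_div hr.flip (fun k => (hs k).flip)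
    (fun k => (hm k).trans_eq (hms k).symm)
  simp only [hms] at hψ
  have hψ : ∀ a b, f r a ≤ f r b →
      Tendsto (fun k => (count (_root_.flip f) r (x k) a b : ℝ) / count f q (y k) r r₁)
        (hyperfilter ℕ) (𝓝 (ψ b - ψ a)) := hψ
  have monoψ : ∀ a b, f r a ≤ f r b → ψ a ≤ ψ b := monoψ
  have strictψ : ∀ a b, f r a < f r b → ψ a < ψ b := strictψ
  -- equally valued intervals of the two factors have equal counts, so their lengths compare
  have le_imp : ∀ a b a' b', f a b ≤ f a' b' → φ a + ψ b ≤ φ a' + ψ b' := by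
    intro a b a' b' hle
    rcases le_total (f a q) (f a' q) with ha | ha <;> rcases le_total (f r b) (f r b') with hb | hb
    · exact add_le_add (monoφ _ _ ha) (monoψ _ _ hb)
    · have := le_of_tendsto_of_tendsto' (hψ _ _ hb) (hφ _ _ ha) fun k => by
        have := h.le_count_flip (hs k) hle
        gcongr
      linarith
    · have := le_of_tendsto_of_tendsto' (hφ _ _ ha) (hψ _ _ hb) fun k => by
        have := h.count_flip_le (hs k) hle
        gcongr
      linarith
    · have ha' : f a b ≤ f a' b := hle.trans (h.indep_right a' hb)
      have hb' : f a b ≤ f a b' := hle.trans (h.indep_left b' ha)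
      exact add_le_add (monoφ _ _ (h.indep_left q ha')) (monoψ _ _ (h.indep_right r hb'))
  -- a strict preference leaves room to lower one coordinate of the better pair
  have lt_imp : ∀ a b a' b', f a b < f a' b' → φ a + ψ b < φ a' + ψ b' := by
    intro a b a' b' hlt
    rcases lt_or_ge (f a q) (f a' q) with ha | ha
    · obtain ⟨c, hc, hc'⟩ : ∃ c, f a b ≤ f c b' ∧ f c q < f a' q := by
        rcases le_total (f a b) (f a b') with hb | hb
        · exact ⟨a, hb, ha⟩
        · obtain ⟨c, hc⟩ := h.exists_eq_left hb hlt.le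
          exact ⟨c, hc.ge, h.indep_left_lt q (hc.trans_lt hlt)⟩
      linarith [le_imp _ _ _ _ hc, strictφ _ _ hc']
    · have hab : f a b < f a b' := hlt.trans_le (h.indep_left b' ha)
      obtain ⟨c, hc, hc'⟩ : ∃ c, f a b ≤ f a' c ∧ f r c < f r b' := by
        rcases le_total (f a b) (f a' b) with hb | hb
        · exact ⟨b, hb, h.indep_right_lt r hab⟩
        · obtain ⟨c, hc⟩ := h.exists_eq_right hb hlt.le
          exact ⟨c, hc.ge, h.indep_right_lt r (hc.trans_lt hlt)⟩
      linarith [le_imp _ _ _ _ hc, strictψ _ _ hc']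
  refine ⟨φ, ψ, fun a b a' b' => ⟨le_imp a b a' b', fun hle => ?_⟩⟩
  by_contra! hlt
  exact (lt_imp _ _ _ _ hlt).not_ge hle

/-- In an additive representation the small steps have small values, so that it is continuous. -/
theorem continuous_of_isAdditiveRep [PreconnectedSpace X] [PreconnectedSpace Y]
    (h : IsConjoint f) {φ : X → ℝ} {ψ : Y → ℝ} (H : IsAdditiveRep f φ ψ) {r r₁ : X} {q q₁ : Y}
    (hr : IsStep f r q r₁ q₁) : Continuous φ := by
  have small : ∀ ε > 0, ∃ y, 0 < ψ y - ψ q ∧ ψ y - ψ q < ε := by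
    intro ε hε
    obtain ⟨k, hk⟩ := exists_nat_gt ((φ r₁ - φ r) / ε)
    obtain ⟨x, y, hs, hc⟩ := h.exists_isStep_hasChain hr k (hr.lt.trans_eq hr.eq)
    have h₁ := H.mul_le_of_hasChain hc
    have h₂ := (H.lt_iff _ _ _ _).1 hs.lt
    rw [div_lt_iff₀ hε] at hk
    refine ⟨y, by linarith, ?_⟩
    exact lt_of_mul_lt_mul_left (h₁.trans_lt hk) k.cast_nonneg
  rw [continuous_iff_continuousAt]
  intro a
  rw [ContinuousAt, tendsto_order]
  constructor
  · intro l hl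
    obtain ⟨y, h₁, h₂⟩ := small (φ a - l) (by linarith)
    have hop : IsOpen {x | f a q < f x y} := isOpen_lt continuous_const (h.cont_left y)
    filter_upwards [hop.mem_nhds ((H.lt_iff _ _ _ _).2 (by linarith))] with x hx
    have := (H.lt_iff _ _ _ _).1 hx
    linarith
  · intro l hl
    obtain ⟨y, h₁, h₂⟩ := small (l - φ a) (by linarith)
    have hop : IsOpen {x | f x q < f a y} := isOpen_lt (h.cont_left q) continuous_const
    filter_upwards [hop.mem_nhds ((H.lt_iff _ _ _ _).2 (by linarith))] with x hx
    have := (H.lt_iff _ _ _ _).1 hx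
    linarith

end IsConjoint

end Additive

/-! ### From local to global additivity -/

/-- A separately continuous function on a product of connected spaces whose mixed differences
vanish on all rectangles with small oscillation at the corners has no mixed differences at all.
The size of the rectangles is measured by the values of the function only. -/
theorem mixed_difference_eq_zero {X Y : Type*} [TopologicalSpace X] [TopologicalSpace Y]
    [PreconnectedSpace X] [PreconnectedSpace Y] {F : X → Y → ℝ}
    (hX : ∀ y, Continuous fun x => F x y) (hY : ∀ x, Continuous fun y => F x y) {ε : ℝ}
    (hε : 0 < ε)
    (hloc : ∀ x x' y y', (∀ a ∈ ({F x y, F x' y, F x y', F x' y'} : Set ℝ),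
      ∀ b ∈ ({F x y, F x' y, F x y', F x' y'} : Set ℝ), a - b ≤ ε) →
      F x y + F x' y' = F x' y + F x y')
    (x x' : X) (y y' : Y) : F x y + F x' y' = F x' y + F x y' := by
  -- if `y` and `y'` are close at one point `x₀`, the effect of replacing `y` by `y'` is constant
  have const_of_close : ∀ y y' x₀, |F x₀ y' - F x₀ y| < ε / 2 →
      ∀ x, F x y' - F x y = F x₀ y' - F x₀ y := by
    intro y y' x₀ hclose
    have hcl : IsClopen {x | F x y' - F x y = F x₀ y' - F x₀ y} := by
      refine ⟨isClosed_eq ((hX y').sub (hX y)) continuous_const, ?_⟩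
      rw [isOpen_iff_mem_nhds]
      intro x hx
      have hx : F x y' - F x y = F x₀ y' - F x₀ y := hx
      have h₁ := Metric.tendsto_nhds.1 ((hX y).tendsto x) (ε / 4) (by linarith)
      have h₂ := Metric.tendsto_nhds.1 ((hX y').tendsto x) (ε / 4) (by linarith)
      filter_upwards [h₁, h₂] with x' h₁ h₂
      rw [Real.dist_eq, abs_lt] at h₁ h₂
      rw [← hx, abs_lt] at hclose
      have := hloc x x' y y' (by
        simp only [mem_insert_iff, mem_singleton_iff, forall_eq_or_imp, forall_eq]
        refine ⟨⟨?_, ?_, ?_, ?_⟩, ⟨?_, ?_, ?_, ?_⟩, ⟨?_, ?_, ?_, ?_⟩, ⟨?_, ?_, ?_, ?_⟩⟩ <;>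
          linarith)
      change F x' y' - F x' y = F x₀ y' - F x₀ y
      linarith
    exact eq_univ_iff_forall.1 (hcl.eq_univ ⟨x₀, rfl⟩)
  have key : ∀ y'', (∀ z, F z y'' - F z y = F x y'' - F x y) := by
    let W : Set Y := {y'' | ∀ z, F z y'' - F z y = F x y'' - F x y}
    have hnear : ∀ y₁, ∀ᶠ y₂ in 𝓝 y₁, (y₁ ∈ W ↔ y₂ ∈ W) := by
      intro y₁
      have h₁ := Metric.tendsto_nhds.1 ((hY x).tendsto y₁) (ε / 2) (by linarith)
      filter_upwards [h₁] with y₂ h₁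
      have h₂ := const_of_close y₁ y₂ x h₁
      constructor
      · intro h z
        linarith [h z, h₂ z]
      · intro h z
        linarith [h z, h₂ z]
    have hW : IsClopen W := by
      constructor
      · rw [← isOpen_compl_iff, isOpen_iff_mem_nhds]
        intro y₁ hy₁
        filter_upwards [hnear y₁] with y₂ h₂ h₃
        exact hy₁ (h₂.2 h₃)
      · rw [isOpen_iff_mem_nhds]
        intro y₁ hy₁
        filter_upwards [hnear y₁] with y₂ h₂
        exact h₂.1 hy₁
    have huniv : W = univ := hW.eq_univ ⟨y, fun z => by rw [sub_self, sub_self]⟩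
    exact eq_univ_iff_forall.1 huniv
  linarith [key y' x']

/-- A level `A` of `I + J` is written as `p + q` in such a way that `p` and `q` can be lowered
inside `I` and `J` by prescribed amounts of at most `ε`. -/
theorem exists_add_eq_of_center_le {I J : Set ℝ} (hI : I.OrdConnected) (hJ : J.OrdConnected)
    {c d ε : ℝ} (hc : c - ε ∈ I) (hd : d - ε ∈ J) (hc' : c ∈ I) (hd' : d ∈ J)
    {p₀ q₀ β γ : ℝ} (hp : p₀ ∈ I) (hq : q₀ ∈ J) (hβ : 0 ≤ β) (hβε : β ≤ ε) (hγ : 0 ≤ γ)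
    (hγε : γ ≤ ε) (hA : c + d ≤ p₀ + q₀) :
    ∃ p ∈ I, ∃ q ∈ J, p - β ∈ I ∧ q - γ ∈ J ∧ p + q = p₀ + q₀ := by
  have hp₁ : max p₀ c ∈ I := by rcases max_choice p₀ c with h | h <;> rwa [h]
  have hq₁ : max q₀ d ∈ J := by rcases max_choice q₀ d with h | h <;> rwa [h]
  have e₁ := le_max_left p₀ c
  have e₂ := le_max_left q₀ d
  have e₃ := le_max_right q₀ d
  obtain ⟨p, q, h₁, h₂, h₃, h₄, h₅⟩ : ∃ p q, c ≤ p ∧ p ≤ max p₀ c ∧ d ≤ q ∧ q ≤ max q₀ d ∧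
      p + q = p₀ + q₀ := by
    rcases le_total c (p₀ + q₀ - max q₀ d) with h | h
    · exact ⟨_, max q₀ d, h, by linarith, e₃, le_rfl, by ring⟩
    · exact ⟨c, p₀ + q₀ - c, le_rfl, le_max_right _ _, by linarith, by linarith, by ring⟩
  exact ⟨p, hI.out hc hp₁ ⟨by linarith, h₂⟩, q, hJ.out hd hq₁ ⟨by linarith, h₄⟩,
    hI.out hc hp₁ ⟨by linarith, by linarith⟩, hJ.out hd hq₁ ⟨by linarith, by linarith⟩, h₅⟩

/-- The counterpart of `exists_add_eq_of_center_le` for raising `p` and `q`. -/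
theorem exists_add_eq_of_le_center {I J : Set ℝ} (hI : I.OrdConnected) (hJ : J.OrdConnected)
    {c d ε : ℝ} (hc : c + ε ∈ I) (hd : d + ε ∈ J) (hc' : c ∈ I) (hd' : d ∈ J)
    {p₀ q₀ β γ : ℝ} (hp : p₀ ∈ I) (hq : q₀ ∈ J) (hβ : 0 ≤ β) (hβε : β ≤ ε) (hγ : 0 ≤ γ)
    (hγε : γ ≤ ε) (hA : p₀ + q₀ ≤ c + d) :
    ∃ p ∈ I, ∃ q ∈ J, p + β ∈ I ∧ q + γ ∈ J ∧ p + q = p₀ + q₀ := by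
  have hp₁ : min p₀ c ∈ I := by rcases min_choice p₀ c with h | h <;> rwa [h]
  have hq₁ : min q₀ d ∈ J := by rcases min_choice q₀ d with h | h <;> rwa [h]
  have e₁ := min_le_left p₀ c
  have e₂ := min_le_left q₀ d
  have e₃ := min_le_right q₀ d
  obtain ⟨p, q, h₁, h₂, h₃, h₄, h₅⟩ : ∃ p q, p ≤ c ∧ min p₀ c ≤ p ∧ q ≤ d ∧ min q₀ d ≤ q ∧
      p + q = p₀ + q₀ := by
    rcases le_total (p₀ + q₀ - min q₀ d) c with h | h
    · exact ⟨_, min q₀ d, h, by linarith, e₃, le_rfl, by ring⟩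
    · exact ⟨c, p₀ + q₀ - c, le_rfl, min_le_right _ _, by linarith, by linarith, by ring⟩
  exact ⟨p, hI.out hp₁ hc ⟨h₂, by linarith⟩, q, hJ.out hq₁ hd ⟨h₄, by linarith⟩,
    hI.out hp₁ hc ⟨by linarith, by linarith⟩, hJ.out hq₁ hd ⟨by linarith, by linarith⟩, h₅⟩

/-! ### Orders and their utilities -/

/-- A continuous weak order is induced by a continuous map to a linear order, the quotient by
indifference. -/
theorem exists_continuous_linearOrder.{u} {X : Type u} [TopologicalSpace X] {R : X → X → Prop}
    (hR : IsPreferenceOrder R) (hc : IsContinuousOrder R) :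
    ∃ (Z : Type u) (_ : LinearOrder Z) (_ : TopologicalSpace Z) (_ : OrderTopology Z) (c : X → Z),
      Continuous c ∧ ∀ p q, c p ≤ c q ↔ R q p := by
  classical
  let _ : Preorder X :=
    { le := fun p q => R q p
      le_refl := fun p => (hR.total p p).elim id id
      le_trans := fun p q r h₁ h₂ => hR.trans r q p h₂ h₁ }
  have _ : Std.Total (α := X) (· ≤ ·) := ⟨fun p q => hR.total q p⟩
  let _ : TopologicalSpace (Antisymmetrization X (· ≤ ·)) := Preorder.topology _
  have _ : OrderTopology (Antisymmetrization X (· ≤ ·)) := ⟨rfl⟩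
  refine ⟨Antisymmetrization X (· ≤ ·), inferInstance, inferInstance, inferInstance,
    toAntisymmetrization (· ≤ ·), ?_, fun p q => Iff.rfl⟩
  refine continuous_generateFrom_iff.2 ?_
  rintro _ ⟨z, rfl | rfl⟩
  · induction z using Antisymmetrization.ind with
    | _ z => exact (hc z).1
  · induction z using Antisymmetrization.ind with
    | _ z => exact (hc z).2

theorem Represents.strictPref_iff {X : Type*} {R : X → X → Prop} {w : X → ℝ}
    (hw : Represents w R) (p q : X) : StrictPref R p q ↔ w q < w p := by
  rw [StrictPref, hw, hw, not_le]
  exact ⟨fun h => h.2, fun h => ⟨h.le, h⟩⟩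

/-- A utility without gaps in its range that represents a continuous order is continuous. -/
theorem Represents.continuous {X : Type*} [TopologicalSpace X] {R : X → X → Prop} {w : X → ℝ}
    (hw : Represents w R) (hc : IsContinuousOrder R) (hrange : (range w).OrdConnected) :
    Continuous w := by
  rw [continuous_iff_continuousAt]
  intro p
  rw [ContinuousAt, tendsto_order]
  constructor
  · intro l hl
    by_cases hq : ∃ q, w q ≤ l
    · obtain ⟨q, hq⟩ := hq
      obtain ⟨m, rfl⟩ := hrange.out (mem_range_self q) (mem_range_self p) ⟨hq, hl.le⟩
      filter_upwards [(hc m).1.mem_nhds ((hw.strictPref_iff _ _).2 hl)] with x hx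
      exact (hw.strictPref_iff _ _).1 hx
    · push Not at hq
      exact Eventually.of_forall hq
  · intro l hl
    by_cases hq : ∃ q, l ≤ w q
    · obtain ⟨q, hq⟩ := hq
      obtain ⟨m, rfl⟩ := hrange.out (mem_range_self p) (mem_range_self q) ⟨hl.le, hq⟩
      filter_upwards [(hc m).2.mem_nhds ((hw.strictPref_iff _ _).2 hl)] with x hx
      exact (hw.strictPref_iff _ _).1 hx
    · push Not at hq
      exact Eventually.of_forall hq

/-! ### Additively separable utilities -/

section Separable

variable {n : ℕ} {S₀ : Type*} {S : Fin n → Type*}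

theorem IsAdditivelySeparable.add_swap {w : Profile S₀ S → ℝ} (hw : IsAdditivelySeparable w)
    (s₀ : S₀) (s t : ∀ k, S k) (i : Fin n) :
    w (s₀, s) + w (s₀, t) = w (s₀, swap s t i) + w (s₀, swap t s i) := by
  obtain ⟨g, hg⟩ := hw
  simp only [hg, ← Finset.sum_add_distrib]
  refine Finset.sum_congr rfl fun k _ => ?_
  rcases eq_or_ne k i with rfl | hk
  · simp [add_comm]
  · simp [hk]

/-- A function that is additive between each opponent and the others is a sum over the opponents:
the coordinates of a base profile `o` are replaced one by one.  Opponent `i` takes the constant. -/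
theorem isAdditivelySeparable_of_mixed_difference {w : Profile S₀ S → ℝ} (i : Fin n)
    (o : ∀ k, S k)
    (h : ∀ (s₀ : S₀) (k : Fin n) (x x' : S k) (y y' : ∀ k, S k),
      w (s₀, Function.update y k x) + w (s₀, Function.update y' k x') =
        w (s₀, Function.update y k x') + w (s₀, Function.update y' k x)) :
    IsAdditivelySeparable w := by
  classical
  have key : ∀ (s₀ : S₀) (s : ∀ k, S k) (T : Finset (Fin n)),
      w (s₀, T.piecewise s o) - w (s₀, o) =
        ∑ k ∈ T, (w (s₀, Function.update o k (s k)) - w (s₀, o)) := by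
    intro s₀ s T
    induction T using Finset.induction_on with
    | empty => simp
    | insert k T hk ih =>
      rw [Finset.sum_insert hk, ← ih, Finset.piecewise_insert]
      have h₁ := h s₀ k (o k) (s k) (T.piecewise s o) o
      have h₂ : Function.update (T.piecewise s o) k (o k) = T.piecewise s o := by
        rw [Function.update_eq_self_iff, Finset.piecewise_eq_of_notMem _ _ _ hk]
      rw [h₂, Function.update_eq_self] at h₁
      linarith
  refine ⟨fun k s₀ x => w (s₀, Function.update o k x) - w (s₀, o) +
    if k = i then w (s₀, o) else 0, fun s₀ s => ?_⟩
  have := key s₀ s Finset.univ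
  rw [Finset.piecewise_univ] at this
  rw [Finset.sum_add_distrib, ← this]
  simp

theorem IsSeparable.isJointlyIndependent {R : Profile S₀ S → Profile S₀ S → Prop}
    (h : IsSeparable R) : IsJointlyIndependent R := by
  obtain ⟨w, hw, hrep⟩ := h
  intro s₀ s₀' i j s s' t t' h₁ h₂ h₃
  have e := hw.add_swap s₀ s t i
  have e' := hw.add_swap s₀' s' t' j
  rw [hrep] at h₁ h₂ h₃
  refine ⟨(hrep _ _).2 (by linarith), ?_⟩
  simp only [hrep.strictPref_iff]
  rintro (h | h | h) <;> linarith

/-- Joint independence for indifference: three corners of a rectangle determine the level of the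
fourth, whatever the action of the focal player and the direction of the rectangle. -/
theorem IsJointlyIndependent.eq_of_eq {R : Profile S₀ S → Profile S₀ S → Prop}
    (hJ : IsJointlyIndependent R) {w : Profile S₀ S → ℝ} (hw : Represents w R) {s₀ s₀' : S₀}
    {i j : Fin n} {s s' t t' : ∀ k, S k} (h₁ : w (s₀, s) = w (s₀', s'))
    (h₂ : w (s₀, swap s t i) = w (s₀', swap s' t' j))
    (h₃ : w (s₀, swap t s i) = w (s₀', swap t' s' j)) : w (s₀, t) = w (s₀', t') := by
  refine le_antisymm ?_ ?_
  · exact (hw _ _).1 (hJ s₀ s₀' i j s s' t t' ((hw _ _).2 h₁.ge) ((hw _ _).2 h₂.le)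
      ((hw _ _).2 h₃.le)).1
  · exact (hw _ _).1 (hJ s₀' s₀ j i s' s t' t ((hw _ _).2 h₁.le) ((hw _ _).2 h₂.ge)
      ((hw _ _).2 h₃.ge)).1

/-- Additivity on small rectangles.  The four levels at the corners of a rectangle at `s₀` are
reproduced at the corners of a rectangle at `e₀`, where the utility is `φ + ψ`.  The rectangle is
built from a largest corner if that lies above the level `c + d`, and from a smallest one
otherwise, so that there is room for it. -/
theorem IsJointlyIndependent.add_swap_of_small {R : Profile S₀ S → Profile S₀ S → Prop}
    (hJ : IsJointlyIndependent R) {w : Profile S₀ S → ℝ} (hw : Represents w R) {e₀ : S₀}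
    {i : Fin n} {φ : S i → ℝ} {ψ : (∀ k, S k) → ℝ}
    (he : ∀ x y, w (e₀, Function.update y i x) = φ x + ψ y)
    (hlevel : ∀ p, ∃ x y, w p = φ x + ψ y)
    (hφ : (range φ).OrdConnected) (hψ : (range ψ).OrdConnected) {c d ε : ℝ} (hε : 0 ≤ ε)
    (hc : c - ε ∈ range φ) (hc' : c + ε ∈ range φ) (hd : d - ε ∈ range ψ) (hd' : d + ε ∈ range ψ)
    (s₀ : S₀) (k : Fin n) (s t : ∀ k, S k)
    (hsmall : ∀ a ∈ ({w (s₀, s), w (s₀, swap s t k), w (s₀, swap t s k), w (s₀, t)} : Set ℝ),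
      ∀ b ∈ ({w (s₀, s), w (s₀, swap s t k), w (s₀, swap t s k), w (s₀, t)} : Set ℝ),
        a - b ≤ ε) :
    w (s₀, s) + w (s₀, t) = w (s₀, swap s t k) + w (s₀, swap t s k) := by
  have hcm : c ∈ range φ := hφ.out hc hc' ⟨by linarith, by linarith⟩
  have hdm : d ∈ range ψ := hψ.out hd hd' ⟨by linarith, by linarith⟩
  -- three corners reproduced at `e₀` force the fourth
  have copy : ∀ (s t : ∀ k, S k) (x x' : S i) (y y' : ∀ k, S k), w (s₀, s) = φ x + ψ y →
      w (s₀, swap s t k) = φ x' + ψ y → w (s₀, swap t s k) = φ x + ψ y' →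
      w (s₀, s) + w (s₀, t) = w (s₀, swap s t k) + w (s₀, swap t s k) := by
    intro s t x x' y y' h₁ h₂ h₃
    have := hJ.eq_of_eq hw (s₀ := s₀) (s₀' := e₀) (i := k) (j := i) (s := s) (t := t)
      (s' := Function.update y i x) (t' := Function.update y' i x')
      (by rw [h₁, he]) (by simp [swap, h₂, he]) (by simp [swap, h₃, he])
    rw [he] at this
    linarith
  have top : ∀ s t : ∀ k, S k, w (s₀, swap s t k) ≤ w (s₀, s) → w (s₀, swap t s k) ≤ w (s₀, s) →
      w (s₀, s) - w (s₀, swap s t k) ≤ ε → w (s₀, s) - w (s₀, swap t s k) ≤ ε →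
      c + d ≤ w (s₀, s) →
      w (s₀, s) + w (s₀, t) = w (s₀, swap s t k) + w (s₀, swap t s k) := by
    intro s t h₁ h₂ h₃ h₄ h₅
    obtain ⟨x₀, y₀, h₀⟩ := hlevel (s₀, s)
    obtain ⟨_, ⟨x, rfl⟩, _, ⟨y, rfl⟩, ⟨x', hx'⟩, ⟨y', hy'⟩, hsum⟩ :=
      exists_add_eq_of_center_le hφ hψ hc hd hcm hdm (mem_range_self x₀) (mem_range_self y₀)
        (sub_nonneg.2 h₁) h₃ (sub_nonneg.2 h₂) h₄ (h₀ ▸ h₅)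
    exact copy s t x x' y y' (by linarith) (by linarith) (by linarith)
  have bot : ∀ s t : ∀ k, S k, w (s₀, s) ≤ w (s₀, swap s t k) → w (s₀, s) ≤ w (s₀, swap t s k) →
      w (s₀, swap s t k) - w (s₀, s) ≤ ε → w (s₀, swap t s k) - w (s₀, s) ≤ ε →
      w (s₀, s) ≤ c + d →
      w (s₀, s) + w (s₀, t) = w (s₀, swap s t k) + w (s₀, swap t s k) := by
    intro s t h₁ h₂ h₃ h₄ h₅
    obtain ⟨x₀, y₀, h₀⟩ := hlevel (s₀, s)
    obtain ⟨_, ⟨x, rfl⟩, _, ⟨y, rfl⟩, ⟨x', hx'⟩, ⟨y', hy'⟩, hsum⟩ :=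
      exists_add_eq_of_le_center hφ hψ hc' hd' hcm hdm (mem_range_self x₀) (mem_range_self y₀)
        (sub_nonneg.2 h₁) h₃ (sub_nonneg.2 h₂) h₄ (h₀ ▸ h₅)
    exact copy s t x x' y y' (by linarith) (by linarith) (by linarith)
  simp only [mem_insert_iff, mem_singleton_iff, forall_eq_or_imp, forall_eq] at hsmall
  obtain ⟨⟨-, hAB, hAC, -⟩, ⟨hBA, -, -, hBD⟩, ⟨hCA, -, -, hCD⟩, ⟨-, hDB, hDC, -⟩⟩ := hsmall
  have e₁ : swap (swap s t k) (swap t s k) k = s := by simp [swap]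
  have e₂ : swap (swap t s k) (swap s t k) k = t := by simp [swap]
  have topA := top s t
  have topD := top t s
  have topB := top (swap s t k) (swap t s k)
  have topC := top (swap t s k) (swap s t k)
  have botA := bot s t
  have botD := bot t s
  have botB := bot (swap s t k) (swap t s k)
  have botC := bot (swap t s k) (swap s t k)
  rw [e₁, e₂] at topB topC botB botC
  -- the remaining case analysis picks a corner that is largest or smallest among its neighbours
  clear top bot copy e₁ e₂
  generalize w (s₀, s) = A at *
  generalize w (s₀, t) = D at *
  generalize w (s₀, swap s t k) = B at *
  generalize w (s₀, swap t s k) = C at *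
  by_contra hne
  grind

end Separable

/-! ### The factorization at the reference action -/

section Factorization

variable {n : ℕ} {S₀ : Type*} {S : Fin n → Type*}
  {R : Profile S₀ S → Profile S₀ S → Prop} {Z : Type*} [LinearOrder Z]

/-- The order at the action `e₀`, seen as an order on the product of the actions of opponent `i`
and the actions of all others.  The second factor is the space of all opponent profiles, of which
the coordinate `i` is disregarded. -/
def factor (c : Profile S₀ S → Z) (e₀ : S₀) (i : Fin n) (x : S i) (y : ∀ k, S k) : Z :=
  c (e₀, Function.update y i x)

/-- At `e₀` a separable utility splits into a function of the action of `i` and one of the others'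
actions. -/
theorem IsAdditivelySeparable.apply_update_eq {w : Profile S₀ S → ℝ}
    (hw : IsAdditivelySeparable w) (e₀ : S₀) (i : Fin n) (o : ∀ k, S k) (x : S i)
    (y : ∀ k, S k) : w (e₀, Function.update y i x) =
      w (e₀, Function.update o i x) + (w (e₀, Function.update y i (o i)) - w (e₀, o)) := by
  have := hw.add_swap e₀ (Function.update y i x) o i
  simp only [swap, Function.update_idem, Function.update_self] at this
  linarith

theorem IsAdditivelySeparable.affine {w w' : Profile S₀ S → ℝ} (hw : IsAdditivelySeparable w)
    (i : Fin n) {a b : ℝ} (h : ∀ p, w' p = a * w p + b) : IsAdditivelySeparable w' := by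
  obtain ⟨g, hg⟩ := hw
  refine ⟨fun k s₀ x => a * g k s₀ x + if k = i then b else 0, fun s₀ s => ?_⟩
  rw [h, hg, Finset.sum_add_distrib, ← Finset.mul_sum]
  simp

theorem IsAdditivelySeparable.isAdditiveRep_factor {c : Profile S₀ S → Z}
    (hcR : ∀ p q, c p ≤ c q ↔ R q p) {w : Profile S₀ S → ℝ} (hw : IsAdditivelySeparable w)
    (hrep : Represents w R) (e₀ : S₀) (i : Fin n) (o : ∀ k, S k) :
    IsAdditiveRep (factor c e₀ i) (fun x => w (e₀, Function.update o i x))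
      (fun y => w (e₀, Function.update y i (o i)) - w (e₀, o)) := by
  intro a b a' b'
  rw [factor, factor, hcR, hrep, hw.apply_update_eq e₀ i o, hw.apply_update_eq e₀ i o a']

variable [TopologicalSpace S₀] [∀ i, TopologicalSpace (S i)]

/-- Triple cancellation is joint independence with the same action of the focal player and the same
opponent on both sides. -/
theorem IsJointlyIndependent.isConjoint_factor [TopologicalSpace Z]
    (hJ : IsJointlyIndependent R) {c : Profile S₀ S → Z} (hc : Continuous c)
    (hcR : ∀ p q, c p ≤ c q ↔ R q p) (e₀ : S₀) (i : Fin n) : IsConjoint (factor c e₀ i) where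
  cont_left y := hc.comp (continuous_const.prodMk (continuous_const.update i continuous_id))
  cont_right x := hc.comp (continuous_const.prodMk (continuous_id.update i continuous_const))
  cancel := by
    intro a a' c c' b b' d d' h₁ h₂ h₃
    have := (hJ e₀ e₀ i i (Function.update b i a) (Function.update b' i a')
      (Function.update d i c) (Function.update d' i c') ((hcR _ _).1 h₁)
      (by simpa [swap] using (hcR _ _).1 h₂) (by simpa [swap] using (hcR _ _).1 h₃)).1
    exact (hcR _ _).2 this

theorem IsJointlyIndependent.exists_isStep_factor [∀ i, ConnectedSpace (S i)]
    [TopologicalSpace Z] [OrderTopology Z] (hJ : IsJointlyIndependent R) {c : Profile S₀ S → Z}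
    (hc : Continuous c) (hcR : ∀ p q, c p ≤ c q ↔ R q p) {e₀ : S₀} {i j : Fin n} (hij : i ≠ j)
    (hi : IsEssentialAt R e₀ i) (hj : IsEssentialAt R e₀ j) :
    ∃ r q r₁ q₁, IsStep (factor c e₀ i) r q r₁ q₁ := by
  have lt_iff : ∀ p q, StrictPref R q p ↔ c p < c q := fun p q => by
    rw [lt_iff_le_not_ge, hcR, hcR, StrictPref]
  obtain ⟨s, a, b, hab⟩ := hi
  obtain ⟨t, a', b', hab'⟩ := hj
  rw [lt_iff] at hab hab'
  refine (hJ.isConjoint_factor hc hcR e₀ i).exists_isStep_of_lt (a := a) (a' := b) (c := t i)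
    (b := Function.update t j a') (b' := Function.update t j b') (d := s) hab ?_
  have e : ∀ z : S j, Function.update (Function.update t j z) i (t i) = Function.update t j z := by
    intro z
    rw [Function.update_eq_self_iff, Function.update_of_ne hij]
  rw [factor, factor, e, e]
  exact hab'

/-- Two additively separable utilities agree up to scale at the reference action by the uniqueness
of two-factor additive representations, and indifference transports this to all profiles. -/
theorem exists_affine_of_represents [∀ i, ConnectedSpace (S i)] (hR : IsPreferenceOrder R)
    (hcont : IsContinuousOrder R) {e₀ : S₀} (hess : HasTwoEssential R e₀)
    (hrich : ∀ p : Profile S₀ S, ∃ s : ∀ i, S i, Indifferent R p (e₀, s))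
    {w w' : Profile S₀ S → ℝ} (hw : IsAdditivelySeparable w) (hrep : Represents w R)
    (hw' : IsAdditivelySeparable w') (hrep' : Represents w' R) :
    ∃ a b : ℝ, 0 < a ∧ ∀ p, w' p = a * w p + b := by
  have hJ : IsJointlyIndependent R := IsSeparable.isJointlyIndependent ⟨w, hw, hrep⟩
  obtain ⟨i, j, hij, hi, hj⟩ := hess
  obtain ⟨Z, _, _, _, c, hc, hcR⟩ := exists_continuous_linearOrder hR hcont
  obtain ⟨r, q, r₁, q₁, hr⟩ := hJ.exists_isStep_factor hc hcR hij hi hj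
  obtain ⟨ρ, hρ, h⟩ := (hJ.isConjoint_factor hc hcR e₀ i).additiveRep_unique
    (hw.isAdditiveRep_factor hcR hrep e₀ i q) (hw'.isAdditiveRep_factor hcR hrep' e₀ i q) hr
  have transport : ∀ {v : Profile S₀ S → ℝ}, Represents v R → ∀ p s, Indifferent R p (e₀, s) →
      v p = v (e₀, s) := fun hv p s hps =>
    le_antisymm ((hv _ _).1 hps.2) ((hv _ _).1 hps.1)
  refine ⟨ρ, w' (e₀, q) - ρ * w (e₀, q), hρ, fun p => ?_⟩
  obtain ⟨s, hs⟩ := hrich p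
  rw [transport hrep p s hs, transport hrep' p s hs]
  have e₁ := hw.apply_update_eq e₀ i q (s i) s
  have e₂ := hw'.apply_update_eq e₀ i q (s i) s
  have h' := h (q i) q (s i) s
  rw [Function.update_eq_self] at e₁ e₂
  simp only [Function.update_eq_self] at h'
  rw [e₁, e₂]
  linear_combination h'

/-- Joint independence yields an additively separable utility: an additive representation at the
reference action is carried to all profiles by indifference, and it is additive on small
rectangles at every action of the focal player, hence on all rectangles. -/
theorem IsJointlyIndependent.isSeparable [∀ i, ConnectedSpace (S i)] (hR : IsPreferenceOrder R)
    (hcont : IsContinuousOrder R) (hJ : IsJointlyIndependent R)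
    {e₀ : S₀} (hess : HasTwoEssential R e₀)
    (hrich : ∀ p : Profile S₀ S, ∃ s : ∀ i, S i, Indifferent R p (e₀, s)) :
    IsSeparable R := by
  obtain ⟨i, j, hij, hi, hj⟩ := hess
  obtain ⟨Z, _, _, _, c, hc, hcR⟩ := exists_continuous_linearOrder hR hcont
  have hf := hJ.isConjoint_factor hc hcR e₀ i
  obtain ⟨r, q, r₁, q₁, hr⟩ := hJ.exists_isStep_factor hc hcR hij hi hj
  obtain ⟨φ, ψ, H⟩ := hf.exists_additiveRep hr
  have hφ := hf.continuous_of_isAdditiveRep H hr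
  have hψ := hf.flip.continuous_of_isAdditiveRep H.flip hr.flip
  choose σ hσ using hrich
  have hσc : ∀ p, c p = factor c e₀ i (σ p i) (σ p) := by
    intro p
    rw [factor, Function.update_eq_self]
    exact le_antisymm ((hcR _ _).2 (hσ p).2) ((hcR _ _).2 (hσ p).1)
  set w : Profile S₀ S → ℝ := fun p => φ (σ p i) + ψ (σ p) with hw
  have hrep : Represents w R := by
    intro p p'
    rw [← hcR, hσc p, hσc p', H]
  have he : ∀ x y, w (e₀, Function.update y i x) = φ x + ψ y := fun x y =>
    (H.eq_iff _ _ _ _).1 (hσc (e₀, Function.update y i x)).symm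
  have hlevel : ∀ p, ∃ x y, w p = φ x + ψ y := fun p => ⟨_, _, rfl⟩
  have hφr : (range φ).OrdConnected := (isPreconnected_range hφ).ordConnected
  have hψr : (range ψ).OrdConnected := (isPreconnected_range hψ).ordConnected
  have hrange : range w = range fun z : S i × (∀ k, S k) => φ z.1 + ψ z.2 := by
    ext v
    constructor
    · rintro ⟨p, rfl⟩
      exact ⟨(σ p i, σ p), rfl⟩
    · rintro ⟨z, rfl⟩
      exact ⟨_, he z.1 z.2⟩
  have hwc : Continuous w := by
    refine hrep.continuous hcont ?_
    rw [hrange]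
    exact (isPreconnected_range
      ((hφ.comp continuous_fst).add (hψ.comp continuous_snd))).ordConnected
  have h₁ := (H.lt_iff _ _ _ _).1 hr.lt
  have h₂ := (H.eq_iff _ _ _ _).1 hr.eq
  -- both ranges contain an interval of length `2 * ε`
  set ε := (ψ q₁ - ψ q) / 2 with hε
  have hεpos : 0 < ε := by rw [hε]; linarith
  have small := hJ.add_swap_of_small hrep he hlevel hφr hψr (c := φ r + ε) (d := ψ q + ε)
    hεpos.le ⟨r, by ring⟩ ⟨r₁, by rw [hε]; linarith⟩ ⟨q, by ring⟩ ⟨q₁, by rw [hε]; ring⟩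
  refine ⟨w, isAdditivelySeparable_of_mixed_difference i q fun s₀ k x x' y y' => ?_, hrep⟩
  refine mixed_difference_eq_zero (F := fun x y => w (s₀, Function.update y k x))
    (fun y => hwc.comp (continuous_const.prodMk (continuous_const.update k continuous_id)))
    (fun x => hwc.comp (continuous_const.prodMk (continuous_id.update k continuous_const)))
    hεpos (fun x x' y y' hsmall => ?_) x x' y y'
  have := small s₀ k (Function.update y k x) (Function.update y' k x')
  simp only [swap, Function.update_idem, Function.update_self] at this
  exact this hsmall

end Factorization

end NetworkGame

theorem mainTheorem1 {n : ℕ} {S₀ : Type*} {S : Fin n → Type*}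
    [TopologicalSpace S₀] [ConnectedSpace S₀]
    [∀ i, TopologicalSpace (S i)] [∀ i, ConnectedSpace (S i)]
    (R : NetworkGame.Profile S₀ S → NetworkGame.Profile S₀ S → Prop)
    (hR : NetworkGame.IsPreferenceOrder R)
    (hcont : NetworkGame.IsContinuousOrder R)
    (hess : ∃ s₀ : S₀, NetworkGame.HasTwoEssential R s₀)
    (hrich : ∃ s₀ : S₀, NetworkGame.HasTwoEssential R s₀ ∧
      ∀ p : NetworkGame.Profile S₀ S, ∃ s : ∀ i, S i, NetworkGame.Indifferent R p (s₀, s)) :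
    (NetworkGame.IsSeparable R ↔ NetworkGame.IsJointlyIndependent R) ∧
    (∀ w : NetworkGame.Profile S₀ S → ℝ,
      NetworkGame.IsAdditivelySeparable w → NetworkGame.Represents w R →
      ∀ w' : NetworkGame.Profile S₀ S → ℝ,
        (NetworkGame.IsAdditivelySeparable w' ∧ NetworkGame.Represents w' R) ↔
          ∃ a b : ℝ, 0 < a ∧ ∀ p, w' p = a * w p + b) := by
  obtain ⟨e₀, hess₀, hrich⟩ := hrich
  refine ⟨⟨fun h => h.isJointlyIndependent, fun h => h.isSeparable hR hcont hess₀ hrich⟩, ?_⟩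
  intro w hw hrep w'
  constructor
  · rintro ⟨hw', hrep'⟩
    exact NetworkGame.exists_affine_of_represents hR hcont hess₀ hrich hw hrep hw' hrep'
  · rintro ⟨a, b, ha, h⟩
    obtain ⟨i, -⟩ := hess₀
    refine ⟨hw.affine i h, fun p p' => ?_⟩
    rw [hrep, h, h, add_le_add_iff_right, mul_le_mul_iff_right₀ ha]
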